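/- Let $G$ be a countable discrete group and let $S \subseteq G$ be any subset. Let $G$ act on $2^G = \{0,1\}^G$ (with the product topology) by the left shift $(g\cdot w)(h) = w(g^{-1}h)$, and let $\mathrm{Free}(2^G) = \{w \in 2^G : g\cdot w \neq w \text{ for all } g \in G \text{ with } g \neq 1_G\}$. To a free Borel action $G \curvearrowright X$ on a standard Borel space $X$ associate the Borel graph $\mathcal{G}_X = \{(x, s\cdot x) : x \in X,\ s \in S\cup S^{-1},\ s \neq 1_G\}$. The Borel chromatic number $\chi_B(\mathcal{G})$ of a Borel graph $\mathcal{G}$ on a standard Borel space $X$ is the minimum cardinality of a standard Borel space $K$ for which there is a Borel map $\kappa : X \to K$ with $\kappa(x) \neq \kappa(y)$ whenever $(x,y)\in\mathcal{G}$. Then for every free Borel action $G \curvearrowright X$ on a standard Borel space, $$\chi_B(\mathcal{G}_X) \leq \chi_B(\mathcal{G}_{\mathrm{Free}(2^G)}).$$ -/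

import Mathlib

open MeasureTheory
open scoped Pointwise

/-- The `2`-shift `2^G`: all functions from `G` to `2 = {0, 1}`. -/
def TwoShift (G : Type*) : Type _ := G → Bool

namespace TwoShift

/-- The product topology (with `2` discrete). -/
instance (G : Type*) : TopologicalSpace (TwoShift G) :=
  inferInstanceAs (TopologicalSpace (G → Bool))

/-- The product σ-algebra; for countable `G` these are the Borel sets of the product topology. -/
instance (G : Type*) : MeasurableSpace (TwoShift G) :=
  inferInstanceAs (MeasurableSpace (G → Bool))

instance (G : Type*) [Countable G] : BorelSpace (TwoShift G) :=
  inferInstanceAs (BorelSpace (G → Bool))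

instance (G : Type*) [Countable G] : StandardBorelSpace (TwoShift G) :=
  inferInstanceAs (StandardBorelSpace (G → Bool))

/-- The left shift action `(g • w) h = w (g⁻¹ h)`. -/
instance (G : Type*) [Group G] : MulAction G (TwoShift G) where
  smul g w := fun h => w (g⁻¹ * h)
  one_smul w := by
    funext h
    change w (1⁻¹ * h) = w h
    simp
  mul_smul a b w := by
    funext h
    change w ((a * b)⁻¹ * h) = w (b⁻¹ * (a⁻¹ * h))
    simp [mul_assoc]

theorem smul_apply {G : Type*} [Group G] (g : G) (w : TwoShift G) (h : G) :
    (g • w) h = w (g⁻¹ * h) := rfl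

instance (G : Type*) [Group G] : MeasurableConstSMul G (TwoShift G) where
  measurable_const_smul g := measurable_pi_lambda _ fun h => measurable_pi_apply (g⁻¹ * h)

end TwoShift

/-- The free part `Free(2^G)`: the points of `2^G` with trivial stabilizer. -/
def freePart (G : Type*) [Group G] : Set (TwoShift G) :=
  {w | ∀ g : G, g ≠ 1 → g • w ≠ w}

theorem smul_mem_freePart {G : Type*} [Group G] (g : G) {w : TwoShift G} (hw : w ∈ freePart G) :
    g • w ∈ freePart G := by
  intro k hk h
  refine hw (g⁻¹ * k * g) (fun h1 => hk ?_) ?_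
  · have h2 : g * (g⁻¹ * k * g) * g⁻¹ = g * 1 * g⁻¹ := by rw [h1]
    simpa [mul_assoc] using h2
  · rw [mul_smul, mul_smul, h, inv_smul_smul]

/-- The restriction of the shift action to the free part. -/
instance (G : Type*) [Group G] : MulAction G (freePart G) where
  smul g w := ⟨g • (w : TwoShift G), smul_mem_freePart g w.2⟩
  one_smul w := Subtype.ext (one_smul G (w : TwoShift G))
  mul_smul a b w := Subtype.ext (mul_smul a b (w : TwoShift G))

theorem freePart_coe_smul {G : Type*} [Group G] (g : G) (w : freePart G) :
    ((g • w : freePart G) : TwoShift G) = g • (w : TwoShift G) := rfl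

/-- The shift action on the free part is free. -/
instance (G : Type*) [Group G] : IsCancelSMul G (freePart G) :=
  isCancelSMul_iff_eq_one_of_smul_eq.mpr fun g w h => by
    by_contra hg
    exact w.2 g hg (congrArg Subtype.val h)

/-- The shift action on the free part is Borel. -/
instance (G : Type*) [Group G] : MeasurableConstSMul G (freePart G) where
  measurable_const_smul g :=
    Measurable.subtype_mk ((measurable_const_smul g).comp measurable_subtype_coe)

theorem measurableSet_freePart (G : Type*) [Group G] [Countable G] :
    MeasurableSet (freePart G) := by
  have h : freePart G = ⋂ g : G, ⋂ _ : g ≠ 1, {w : TwoShift G | g • w = w}ᶜ := by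
    ext w
    simp [freePart]
  rw [h]
  exact MeasurableSet.iInter fun g => MeasurableSet.iInter fun _ =>
    (measurableSet_eq_fun (measurable_const_smul g) measurable_id).compl

instance (G : Type*) [Group G] [Countable G] : StandardBorelSpace (freePart G) :=
  (measurableSet_freePart G).standardBorel

/-- For a free action of `G` on `X` (the class `IsCancelSMul`) and `S ⊆ G`, the graph
`{(x, s • x) | x ∈ X, s ∈ S ∪ S⁻¹, s ≠ 1}` on `X`. -/
def schreierGraph {G : Type*} [Group G] (S : Set G) (X : Type*) [MulAction G X]
    [IsCancelSMul G X] : SimpleGraph X where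
  Adj x y := ∃ s ∈ S ∪ S⁻¹, s ≠ 1 ∧ y = s • x
  symm := ⟨by
    rintro x y ⟨s, hs, hs1, rfl⟩
    refine ⟨s⁻¹, ?_, inv_ne_one.mpr hs1, (inv_smul_smul s x).symm⟩
    rcases hs with hs | hs
    · exact Or.inr (by simpa using hs)
    · exact Or.inl hs⟩
  loopless := ⟨by
    rintro x ⟨s, -, hs1, h⟩
    exact hs1 (IsCancelSMul.eq_one_of_smul h.symm)⟩

/-- For a free Borel action of a countable group, the graph is a Borel subset of `X × X`. -/
theorem measurableSet_schreierGraph {G : Type*} [Group G] [Countable G] (S : Set G) (X : Type*)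
    [MeasurableSpace X] [StandardBorelSpace X] [MulAction G X] [MeasurableConstSMul G X]
    [IsCancelSMul G X] : MeasurableSet {p : X × X | (schreierGraph S X).Adj p.1 p.2} := by
  have h : {p : X × X | (schreierGraph S X).Adj p.1 p.2} =
      ⋃ s : G, ⋃ _ : s ∈ S ∪ S⁻¹ ∧ s ≠ 1, {p : X × X | p.2 = s • p.1} := by
    ext p
    simp only [schreierGraph, Set.mem_ofPred_eq, Set.mem_iUnion, exists_prop, and_assoc]
  rw [h]
  exact MeasurableSet.iUnion fun s => MeasurableSet.iUnion fun _ =>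
    measurableSet_eq_fun measurable_snd ((measurable_const_smul s).comp measurable_fst)

/-- The cardinals `#K` of the standard Borel spaces `K` for which `𝒢` has a Borel `K`-coloring.
Every standard Borel space has a Borel isomorphic copy in the lowest universe, so it is enough
to let `K` range over `Type`. -/
def borelColoringCardinals {X : Type*} [MeasurableSpace X] (𝒢 : SimpleGraph X) :
    Set Cardinal.{0} :=
  {c | ∃ (K : Type) (_ : MeasurableSpace K) (_ : StandardBorelSpace K) (κ : 𝒢.Coloring K),
    Measurable κ ∧ Cardinal.mk K = c}

/-- The Borel chromatic number of a graph on a standard Borel space: the minimum cardinality of a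
standard Borel space `K` for which there is a Borel `K`-coloring. -/
noncomputable def borelChromaticNumber {X : Type*} [MeasurableSpace X] (𝒢 : SimpleGraph X) :
    Cardinal.{0} :=
  sInf (borelColoringCardinals 𝒢)

/-- On a standard Borel space the minimum is attained (there is always a Borel coloring by
real numbers). -/
theorem borelChromaticNumber_mem {X : Type*} [MeasurableSpace X] [StandardBorelSpace X]
    (𝒢 : SimpleGraph X) : borelChromaticNumber 𝒢 ∈ borelColoringCardinals 𝒢 := by
  obtain ⟨f, hf⟩ := exists_measurableEmbedding_real X
  exact csInf_mem ⟨_, ℝ, inferInstance, inferInstance,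
    SimpleGraph.Coloring.mk f fun {_ _} hvw h => hvw.ne (hf.injective h), hf.measurable, rfl⟩

/-! A Borel colouring pulls back along an equivariant Borel map, so it suffices to map X
equivariantly into Free(2^G) (`exists_measurable_equivariant_freePart`). Equivariant Borel maps to
2^G correspond to Borel c : X → 2 via x ↦ (h ↦ c(h⁻¹x)). The image is free exactly when for all g ≠
1 and x some k has c(kx) ≠ c(kgx).

For finite G the indicator of a Borel transversal works. For infinite G the elements g are treated
one at a time: c stays undecided on a Borel set U meeting every Kx for some finite K, and
`exists_separating_extension` decides c on part of U so that g is settled however the rest, again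
syndetic, is filled in.

In one stage, sparse centres v own disjoint blocks inside Bv ∩ U and choose 0-1 patterns there. A
comparison between a block and its translate that involves m independent positions fails for at most
a fraction 2⁻ᵐ of the patterns. The number of comparisons is polynomial in |B|, and |B| is linear in
m, so for suitable m a union bound leaves a good pattern whatever earlier centres chose. Choosing
along a Borel ℕ-colouring that separates nearby centres keeps everything Borel
(`exists_measurable_greedy`). -/

/-! ### Borel greedy choices along a countable colouring -/

section Greedy

variable {G X : Type*} [Group G] [MulAction G X] [MeasurableSpace X] [MeasurableConstSMul G X]

/-- A finite set of nontrivial translations of a free Borel action has a Borel colouring by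
natural numbers. -/
theorem exists_measurable_nat_coloring [StandardBorelSpace X] [IsCancelSMul G X]
    (E : Finset G) (hE : 1 ∉ E) :
    ∃ κ : X → ℕ, Measurable κ ∧ ∀ x, ∀ e ∈ E, κ (e • x) ≠ κ x := by
  classical
  obtain ⟨φ, hφ⟩ := exists_measurableEmbedding_real X
  obtain ⟨I, hI⟩ := exists_surjective_nat (ℚ × ℚ)
  let J : ℕ → Set ℝ := fun n => Set.Ioo ((I n).1 : ℝ) ((I n).2 : ℝ)
  -- Some rational interval isolates `φ x` from the finitely many `φ (e • x)`; the colour is the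
  -- least index of such an interval.
  have hex : ∀ x, ∃ n, φ x ∈ J n ∧ ∀ e ∈ E, φ (e • x) ∉ J n := by
    intro x
    have hopen : IsOpen ((E.image fun e => φ (e • x) : Finset ℝ) : Set ℝ)ᶜ :=
      (Finset.finite_toSet _).isClosed.isOpen_compl
    have hx : φ x ∈ ((E.image fun e => φ (e • x) : Finset ℝ) : Set ℝ)ᶜ := by
      intro h
      obtain ⟨e, he, h⟩ := Finset.mem_image.mp (Finset.mem_coe.mp h)
      have : e = 1 := IsCancelSMul.eq_one_of_smul (hφ.injective h)
      exact hE (this ▸ he)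
    obtain ⟨s, hs, hxs, hsub⟩ :=
      Real.isTopologicalBasis_Ioo_rat.exists_subset_of_mem_open hx hopen
    simp only [Set.mem_iUnion, Set.mem_singleton_iff] at hs
    obtain ⟨a, b, -, rfl⟩ := hs
    obtain ⟨n, hn⟩ := hI (a, b)
    refine ⟨n, by simpa [J, hn] using hxs, fun e he h => ?_⟩
    refine hsub (by simpa [J, hn] using h : φ (e • x) ∈ Set.Ioo (a : ℝ) b) ?_
    exact Finset.mem_coe.mpr (Finset.mem_image.mpr ⟨e, he, rfl⟩)
  refine ⟨fun x => Nat.find (hex x), measurable_find hex fun n => ?_, fun x e he h => ?_⟩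
  · have h1 : ∀ g : G, Measurable fun x : X => φ (g • x) ∈ J n := fun g =>
      measurableSet_setOfPred.mp ((hφ.measurable.comp (measurable_const_smul g)) measurableSet_Ioo)
    have h2 : Measurable fun x : X => φ x ∈ J n :=
      measurableSet_setOfPred.mp (hφ.measurable measurableSet_Ioo)
    refine h2.setOf.inter ?_
    have : {x | ∀ e ∈ E, φ (e • x) ∉ J n} = ⋂ e ∈ E, {x | φ (e • x) ∈ J n}ᶜ := by
      ext; simp
    change MeasurableSet {x | ∀ e ∈ E, φ (e • x) ∉ J n}
    rw [this]
    exact Finset.measurableSet_biInter _ fun e _ => (h1 e).setOf.compl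
  · have h1 := (Nat.find_spec (hex (e • x))).1
    have h2 := (Nat.find_spec (hex x)).2 e he
    simp only at h
    rw [h] at h1
    exact h2 h1

/-- The function obtained from a local rule by recursion along a colouring `κ`. -/
noncomputable def greedy {Q : Type*} (κ : X → ℕ) (E : Finset G)
    (R : X → (E → Option Q) → Q) (x : X) : Q :=
  R x fun e => if _h : κ ((e : G) • x) < κ x then some (greedy κ E R ((e : G) • x)) else none
termination_by κ x

/-- Strong induction on the colour: a value depends only on values at smaller colours, and since `E`
and `Q` are finite there are only finitely many configurations `τ` to split over. -/
theorem measurableSet_greedy_eq {Q : Type*} [Finite Q] {κ : X → ℕ} (hκ : Measurable κ)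
    (E : Finset G) {R : X → (E → Option Q) → Q}
    (hR : ∀ τ q, MeasurableSet {x | R x τ = q}) (q : Q) :
    MeasurableSet {x | greedy κ E R x = q} := by
  have key : ∀ n q, MeasurableSet {x | κ x = n ∧ greedy κ E R x = q} := by
    intro n
    induction n using Nat.strong_induction_on with
    | _ n ih =>
    intro q
    have hlt : ∀ r, MeasurableSet {x | κ x < n ∧ greedy κ E R x = r} := by
      intro r
      have : {x | κ x < n ∧ greedy κ E R x = r} =
          ⋃ k : ℕ, ⋃ _ : k < n, {x | κ x = k ∧ greedy κ E R x = r} := by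
        ext x; simp
      rw [this]
      exact MeasurableSet.iUnion fun k => MeasurableSet.iUnion fun hk => ih k hk r
    have hκn : MeasurableSet {x | κ x < n} := measurableSet_lt hκ measurable_const
    have hval : ∀ (e : E) (o : Option Q), MeasurableSet {x : X |
        (if κ ((e : G) • x) < n then some (greedy κ E R ((e : G) • x)) else none) = o} := by
      rintro e (_ | r)
      · have := (measurable_const_smul (α := X) (e : G)) hκn.compl
        convert this using 1
        ext x; simp
      · have := (measurable_const_smul (α := X) (e : G)) (hlt r)
        convert this using 1
        ext x; simp
    have : {x | κ x = n ∧ greedy κ E R x = q} = ⋃ τ : E → Option Q,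
        ({x | κ x = n} ∩ {x | R x τ = q}) ∩ ⋂ e : E, {x : X |
        (if κ ((e : G) • x) < n then some (greedy κ E R ((e : G) • x)) else none) = τ e} := by
      ext x
      simp only [Set.mem_ofPred_eq, Set.mem_iUnion, Set.mem_inter_iff, Set.mem_iInter]
      constructor
      · rintro ⟨rfl, h⟩
        refine ⟨_, ⟨rfl, ?_⟩, fun e => rfl⟩
        rw [greedy] at h
        simpa using h
      · rintro ⟨τ, ⟨rfl, h⟩, hτ⟩
        refine ⟨rfl, ?_⟩
        rw [greedy, ← h]
        congr 1
        funext e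
        simpa using hτ e
    rw [this]
    exact MeasurableSet.iUnion fun τ => ((hκ (measurableSet_singleton n)).inter (hR τ q)).inter
      (MeasurableSet.iInter fun e => hval e (τ e))
  have : {x | greedy κ E R x = q} = ⋃ n, {x | κ x = n ∧ greedy κ E R x = q} := by
    ext x; simp
  exact this ▸ MeasurableSet.iUnion fun n => key n q

/-- Borel greedy construction: points choose values one colour after the other, each subject to a
satisfiable constraint that depends on the values already chosen by its neighbours. -/
theorem exists_measurable_greedy {Q : Type*} [Finite Q] {κ : X → ℕ} (hκ : Measurable κ)
    (E : Finset G) (P : X → (E → Option Q) → Q → Prop)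
    (hP : ∀ τ q, Measurable fun x => P x τ q) (hex : ∀ x τ, ∃ q, P x τ q) :
    ∃ a : X → Q, (∀ q, MeasurableSet {x | a x = q}) ∧ ∀ x, P x
      (fun e => if κ ((e : G) • x) < κ x then some (a ((e : G) • x)) else none) (a x) := by
  classical
  rcases isEmpty_or_nonempty X with hX | ⟨⟨x₀⟩⟩
  · exact ⟨fun x => hX.elim x, fun q => Set.eq_empty_of_isEmpty {x | hX.elim x = q} ▸ .empty,
      fun x => hX.elim x⟩
  obtain ⟨q₀, -⟩ := hex x₀ fun _ => none
  -- The choice depends only on the set of admissible values, which ranges over finitely many sets;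
  -- this makes `R` measurable. The default `q₀` is never used.
  let Φ : Set Q → Q := fun s => if h : s.Nonempty then h.choose else q₀
  let R : X → (E → Option Q) → Q := fun x τ => Φ {q | P x τ q}
  have hRP : ∀ x τ, P x τ (R x τ) := by
    intro x τ
    have h : {q | P x τ q}.Nonempty := hex x τ
    have h' : R x τ = h.choose := dif_pos h
    rw [h']
    exact h.choose_spec
  have hR : ∀ τ q, MeasurableSet {x | R x τ = q} := by
    intro τ q
    have : {x | R x τ = q} = ⋃ s : Set Q, ⋃ _ : Φ s = q, ⋂ r : Q, {x | P x τ r ↔ r ∈ s} := by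
      ext x
      simp only [Set.mem_ofPred_eq, Set.mem_iUnion, Set.mem_iInter, exists_prop]
      constructor
      · exact fun h => ⟨_, h, fun r => Iff.rfl⟩
      · rintro ⟨s, hs, h⟩
        have : {r | P x τ r} = s := Set.ext h
        simpa [R, this] using hs
    rw [this]
    refine MeasurableSet.iUnion fun s => MeasurableSet.iUnion fun _ => MeasurableSet.iInter fun r =>
      ((hP τ r).iff measurable_const).setOf
  refine ⟨greedy κ E R, measurableSet_greedy_eq hκ E hR, fun x => ?_⟩
  have h := hRP x fun e => if κ ((e : G) • x) < κ x then some (greedy κ E R ((e : G) • x)) else none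
  convert h using 1
  rw [greedy]
  simp

/-- Every Borel set has a Borel subset that is maximal among those containing no two points that
differ by an element of the finite symmetric set `E`. -/
theorem exists_measurable_maximal_separated [StandardBorelSpace X] [IsCancelSMul G X]
    {U : Set X} (hU : MeasurableSet U) (E : Finset G) (hE : 1 ∉ E) (hinv : ∀ e ∈ E, e⁻¹ ∈ E) :
    ∃ W ⊆ U, MeasurableSet W ∧ (∀ w ∈ W, ∀ e ∈ E, e • w ∉ W) ∧
      ∀ x ∈ U, x ∈ W ∨ ∃ e ∈ E, e • x ∈ W := by
  obtain ⟨κ, hκ, hκE⟩ := exists_measurable_nat_coloring (X := X) E hE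
  -- A point of `U` joins unless a neighbour of smaller colour has joined.
  obtain ⟨a, ha, h⟩ := exists_measurable_greedy (Q := Prop) hκ E
    (fun x τ q => q ↔ x ∈ U ∧ ∀ e, τ e ≠ some True)
    (fun τ q => measurable_const.iff (hU.mem.and measurable_const))
    (fun x τ => ⟨_, Iff.rfl⟩)
  refine ⟨{x | a x = True}, ?_, ha _, ?_, ?_⟩
  · intro x hx
    exact ((h x).mp (of_eq_true hx)).1
  · intro w hw e he hew
    rcases lt_or_gt_of_ne (hκE w e he) with hlt | hlt
    · refine ((h w).mp (of_eq_true hw)).2 ⟨e, he⟩ ?_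
      exact (if_pos hlt).trans (congrArg some hew)
    · refine ((h (e • w)).mp (of_eq_true hew)).2 ⟨e⁻¹, hinv e he⟩ ?_
      refine (if_pos (by simpa using hlt)).trans ?_
      simpa using hw
  · intro x hx
    by_contra! hcon
    refine hcon.1 (eq_true ((h x).mpr ⟨hx, fun e hτ => ?_⟩))
    dsimp only at hτ
    split_ifs at hτ
    exact hcon.2 e e.2 (Option.some_injective _ hτ)

end Greedy

/-! ### Finite counting: union bound, independent positions, returns -/

section Counting

/-- If a set of patterns is determined by its restriction to the complement of a set of at least
`m` coordinates, it contains at most the fraction `2⁻ᵐ` of all patterns. -/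
theorem card_mul_two_pow_le {β : Type*} [Fintype β] [DecidableEq β] (A : Finset (β → Bool))
    (T : Finset β) {m : ℕ} (hT : m ≤ T.card)
    (hA : ∀ p ∈ A, ∀ q ∈ A, (∀ b ∉ T, p b = q b) → p = q) :
    A.card * 2 ^ m ≤ 2 ^ Fintype.card β := by
  have h1 : A.card ≤ 2 ^ (Fintype.card β - T.card) := by
    let r : (β → Bool) → (↥(Tᶜ) → Bool) := fun p b => p b
    have hr : Set.InjOn r A := fun p hp q hq hpq =>
      hA p hp q hq fun b hb => congrFun hpq ⟨b, Finset.mem_compl.mpr hb⟩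
    have h := Finset.card_le_card_of_injOn (t := Finset.univ) r (fun _ _ => Finset.mem_univ _) hr
    rwa [Finset.card_univ, Fintype.card_fun, Fintype.card_bool, Fintype.card_coe,
      Finset.card_compl] at h
  calc A.card * 2 ^ m ≤ 2 ^ (Fintype.card β - T.card) * 2 ^ T.card :=
        Nat.mul_le_mul h1 (Nat.pow_le_pow_right two_pos hT)
    _ = 2 ^ Fintype.card β := by
        rw [← pow_add, Nat.sub_add_cancel (Finset.card_le_univ T)]

/-- Union bound: fewer than `2ᵐ` bad sets of relative size at most `2⁻ᵐ` do not cover. -/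
theorem exists_forall_notMem_of_card {β ι : Type*} [Fintype β] [DecidableEq β] (I : Finset ι)
    (A : ι → Finset (β → Bool)) {m : ℕ} (hI : I.card < 2 ^ m)
    (hA : ∀ i ∈ I, (A i).card * 2 ^ m ≤ 2 ^ Fintype.card β) : ∃ p, ∀ i ∈ I, p ∉ A i := by
  by_contra! hcon
  have hcover : (Finset.univ : Finset (β → Bool)) ⊆ I.biUnion A := fun p _ =>
    Finset.mem_biUnion.mpr (hcon p)
  have h1 : 2 ^ Fintype.card β ≤ ∑ i ∈ I, (A i).card := by
    have := (Finset.card_le_card hcover).trans Finset.card_biUnion_le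
    simpa using this
  have h2 : (∑ i ∈ I, (A i).card) * 2 ^ m ≤ I.card * 2 ^ Fintype.card β := by
    rw [Finset.sum_mul]
    exact Finset.sum_le_card_nsmul _ _ _ hA
  have h3 : 2 ^ Fintype.card β * 2 ^ m ≤ I.card * 2 ^ Fintype.card β :=
    (Nat.mul_le_mul_right _ h1).trans h2
  rw [mul_comm] at h3
  exact absurd (Nat.le_of_mul_le_mul_right h3 (by positivity)) (not_le.mpr hI)

/-- A finite set contains a third of its points no two of which differ by the right translation by
`u ≠ 1`. -/
theorem exists_subset_translation_independent {G : Type*} [Group G] (S : Finset G) {u : G}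
    (hu : u ≠ 1) : ∃ T ⊆ S, (∀ b ∈ T, b * u ∉ T) ∧ S.card ≤ 3 * T.card := by
  classical
  obtain ⟨T, hT, hmax⟩ := Finset.exists_max_image
    (S.powerset.filter fun T => ∀ b ∈ T, b * u ∉ T) Finset.card ⟨∅, by simp⟩
  simp only [Finset.mem_filter, Finset.mem_powerset] at hT hmax
  refine ⟨T, hT.1, hT.2, ?_⟩
  -- A point outside these three sets could be added to the maximal `T`.
  have hsub : S ⊆ T ∪ (T.image (· * u⁻¹) ∪ T.image (· * u)) := by
    intro s hs
    by_contra hcon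
    simp only [Finset.mem_union, Finset.mem_image, not_or, not_exists, not_and] at hcon
    obtain ⟨hsT, h1, h2⟩ := hcon
    have := hmax (insert s T) ⟨Finset.insert_subset hs hT.1, fun b hb hbu => ?_⟩
    · rw [Finset.card_insert_of_notMem hsT] at this
      omega
    · rcases Finset.mem_insert.mp hb with rfl | hb <;> rcases Finset.mem_insert.mp hbu with h | h
      · exact hu (mul_eq_left.mp h)
      · exact h1 _ h (by simp)
      · exact h2 _ hb h
      · exact hT.2 b hb h
  have h1 := Finset.card_le_card hsub
  have h2 := Finset.card_union_le T (T.image (· * u⁻¹) ∪ T.image (· * u))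
  have h3 := Finset.card_union_le (T.image (· * u⁻¹)) (T.image (· * u))
  have h4 := Finset.card_image_le (s := T) (f := (· * u⁻¹))
  have h5 := Finset.card_image_le (s := T) (f := (· * u))
  omega

/-- If every orbit segment `K • x` meets `U`, there are finite sets of size linear in `N` such that
every orbit segment of that shape meets `U` at least `N` times. -/
theorem exists_finset_many_returns {G X : Type*} [Group G] [Infinite G] [MulAction G X]
    (U : Set X) (K : Finset G) (hK : ∀ x : X, ∃ k ∈ K, k • x ∈ U) (N : ℕ) :
    ∃ B : Finset G, B.card ≤ N * K.card ∧
      ∀ x : X, ∃ T ⊆ B, N ≤ T.card ∧ ∀ b ∈ T, b • x ∈ U := by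
  classical
  induction N with
  | zero => exact ⟨∅, by simp, fun x => ⟨∅, by simp⟩⟩
  | succ N ih =>
    obtain ⟨B, hB, h⟩ := ih
    -- This makes `K * t` disjoint from `B`, so the return it supplies is new.
    obtain ⟨t, ht⟩ := Infinite.exists_notMem_finset (K⁻¹ * B)
    refine ⟨B ∪ K.image (· * t), ?_, fun x => ?_⟩
    · have h1 := Finset.card_union_le B (K.image (· * t))
      have h2 := Finset.card_image_le (s := K) (f := (· * t))
      rw [Nat.succ_mul]
      omega
    · obtain ⟨T, hTB, hT, hTU⟩ := h x
      obtain ⟨k, hk, hkU⟩ := hK (t • x)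
      have hkt : k * t ∉ B := fun hb => ht (by
        have := Finset.mul_mem_mul (Finset.inv_mem_inv hk) hb
        simpa using this)
      refine ⟨insert (k * t) T, ?_, ?_, ?_⟩
      · refine Finset.insert_subset (Finset.mem_union_right _ (Finset.mem_image_of_mem _ hk)) ?_
        exact hTB.trans Finset.subset_union_left
      · rw [Finset.card_insert_of_notMem fun h => hkt (hTB h)]
        omega
      · intro b hb
        rcases Finset.mem_insert.mp hb with rfl | hb
        · rwa [mul_smul]
        · exact hTU b hb

/-- Exponentials beat polynomials, in the form used to choose block sizes. -/
theorem exists_polynomial_lt_two_pow (k : ℕ) : ∃ m : ℕ, 4 * ((5 * m + 3) * k) ^ 8 < 2 ^ m := by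
  have h : Filter.Tendsto (fun n : ℕ => (n : ℝ) ^ 8 / 2 ^ n) Filter.atTop (nhds 0) :=
    tendsto_pow_const_div_const_pow_of_one_lt 8 one_lt_two
  have hc : (0 : ℝ) < 1 / (4 * (8 * (k + 1)) ^ 8) := by positivity
  obtain ⟨m, hm, hm1⟩ := ((h.eventually_lt_const hc).and (Filter.eventually_ge_atTop 1)).exists
  refine ⟨m, ?_⟩
  rw [div_lt_div_iff₀ (by positivity) (by positivity), one_mul] at hm
  have h1 : m ^ 8 * (4 * (8 * (k + 1)) ^ 8) < 2 ^ m := by exact_mod_cast hm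
  refine lt_of_le_of_lt ?_ h1
  calc 4 * ((5 * m + 3) * k) ^ 8 ≤ 4 * ((8 * m) * (k + 1)) ^ 8 := by
        gcongr <;> omega
    _ = m ^ 8 * (4 * (8 * (k + 1)) ^ 8) := by ring

end Counting

/-! ### Patterns on a finite set of positions -/

section Patterns

open Classical in
/-- Extension of a pattern on the finite set `B` by `false`. -/
noncomputable def patternEval {α : Type*} {B : Finset α} (p : B → Bool) (b : α) : Bool :=
  if h : b ∈ B then p ⟨b, h⟩ else false

theorem card_patterns_mul_two_pow_le {α : Type*} {B S : Finset α} (hSB : S ⊆ B) {m : ℕ}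
    (hm : m ≤ S.card)
    (A : Finset (B → Bool))
    (hA : ∀ p ∈ A, ∀ q ∈ A, (∀ b, b ∉ S → patternEval p b = patternEval q b) →
      ∀ b ∈ S, patternEval p b = patternEval q b) :
    A.card * 2 ^ m ≤ 2 ^ Fintype.card B := by
  classical
  refine card_mul_two_pow_le A (S.subtype (· ∈ B)) ?_ fun p hp q hq hpq => ?_
  · rwa [Finset.card_subtype, Finset.filter_true_of_mem fun b hb => hSB hb]
  · have h1 : ∀ b, b ∉ S → patternEval p b = patternEval q b := by
      intro b hb
      by_cases hbB : b ∈ B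
      · simpa [patternEval, hbB] using hpq ⟨b, hbB⟩ (by simpa using hb)
      · simp [patternEval, hbB]
    funext b
    have h2 : patternEval p b = patternEval q b := by
      by_cases hb : (b : α) ∈ S
      · exact hA p hp q hq h1 b hb
      · exact h1 b hb
    simpa [patternEval] using h2

theorem measurable_le_card_filter {α Y : Type*} [MeasurableSpace Y] (B : Finset α)
    (P : Y → α → Prop) [∀ x, DecidablePred (P x)] (hP : ∀ b, Measurable fun x => P x b)
    (m : ℕ) :
    Measurable fun x => m ≤ (B.filter (P x)).card := by
  have h : Measurable fun x => (B.filter (P x)).card := by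
    simp only [Finset.card_filter]
    exact Finset.measurable_sum _ fun b _ =>
      Measurable.ite (hP b).setOf measurable_const measurable_const
  exact measurableSet_setOfPred.mp (measurableSet_le measurable_const h)

end Patterns

/-! ### Choosing patterns on blocks -/

section Blocks

variable {G X : Type*} [Group G] [MulAction G X]

open Classical in
/-- The positions `b` for which `b • v` lies in the block of `v`, and its partner `(b * u) • v'` in
the block of `v'`. The block of `v` consists of the points of `W` in `B • v`. -/
noncomputable def pairedPositions (B : Finset G) (W : Set X) (v v' : X) (u : G) : Finset G :=
  {b ∈ B | b • v ∈ W ∧ b * u ∈ B ∧ (b * u) • v' ∈ W}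

open Classical in
/-- The positions `b` for which `b • v` lies in the block of `v`, while `(b * h) • v` is outside
`Z` and outside the blocks of all points of `V`. -/
noncomputable def outerPositions (B : Finset G) (W V Z : Set X) (v : X) (h : G) : Finset G :=
  {b ∈ B | b • v ∈ W ∧ (b * h) • v ∉ Z ∧
    ∀ b' ∈ B, (b * h) • v ∈ W → (b'⁻¹ * (b * h)) • v ∉ V}

theorem mem_pairedPositions {B : Finset G} {W : Set X} {v v' : X} {u b : G} :
    b ∈ pairedPositions B W v v' u ↔ b ∈ B ∧ b • v ∈ W ∧ b * u ∈ B ∧ (b * u) • v' ∈ W := by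
  classical
  exact Finset.mem_filter

theorem mem_outerPositions {B : Finset G} {W V Z : Set X} {v : X} {h b : G} :
    b ∈ outerPositions B W V Z v h ↔ b ∈ B ∧ b • v ∈ W ∧ (b * h) • v ∉ Z ∧
      ∀ b' ∈ B, (b * h) • v ∈ W → (b'⁻¹ * (b * h)) • v ∉ V := by
  classical
  exact Finset.mem_filter

/-- Right translation by `u` exchanges the two blocks, so a comparison can be charged to whichever
centre chooses later. -/
theorem card_pairedPositions_inv_le (B : Finset G) (W : Set X) (v v' : X) (u : G) :
    (pairedPositions B W v v' u).card ≤ (pairedPositions B W v' v u⁻¹).card := by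
  refine Finset.card_le_card_of_injOn (· * u) (fun b hb => ?_) (mul_left_injective u).injOn
  obtain ⟨h1, h2, h3, h4⟩ := mem_pairedPositions.mp (Finset.mem_coe.mp hb)
  exact Finset.mem_coe.mpr (mem_pairedPositions.mpr ⟨h3, h4, by simpa using h1, by simpa using h2⟩)

/-- Points of `V` choose, in a Borel way, patterns on their blocks such that every long enough
comparison of a block with the default values `c`, with itself, or with the block of another point
of `V` detects a difference. -/
theorem exists_measurable_patterns [Countable G] [MeasurableSpace X] [StandardBorelSpace X]
    [MeasurableConstSMul G X] [IsCancelSMul G X] {W V Z : Set X} (hW : MeasurableSet W)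
    (hV : MeasurableSet V) (hZ : MeasurableSet Z) {c : X → Bool} (hc : Measurable c)
    (B E D H : Finset G) (hE : 1 ∉ E) (hEinv : ∀ e ∈ E, e⁻¹ ∈ E) (hDinv : ∀ u ∈ D, u⁻¹ ∈ D)
    {m : ℕ} (hm : H.card + (D.card + E.card * D.card) < 2 ^ m) :
    ∃ a : X → B → Bool, (∀ q, MeasurableSet {x | a x = q}) ∧ ∀ v ∈ V,
      (∀ h ∈ H, m ≤ (outerPositions B W V Z v h).card →
        ∃ b ∈ outerPositions B W V Z v h, patternEval (a v) b ≠ c ((b * h) • v)) ∧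
      (∀ u ∈ D, u ≠ 1 → 3 * m ≤ (pairedPositions B W v v u).card →
        ∃ b ∈ pairedPositions B W v v u, patternEval (a v) b ≠ patternEval (a v) (b * u)) ∧
      (∀ e ∈ E, e • v ∈ V → ∀ u ∈ D, m ≤ (pairedPositions B W v (e • v) u).card →
        ∃ b ∈ pairedPositions B W v (e • v) u,
          patternEval (a v) b ≠ patternEval (a (e • v)) (b * u)) := by
  classical
  obtain ⟨κ, hκ, hκE⟩ := exists_measurable_nat_coloring (X := X) E hE
  have hmem : ∀ {A : Set X}, MeasurableSet A → ∀ g : G, Measurable fun x : X => g • x ∈ A :=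
    fun hA g => measurableSet_setOfPred.mp (measurable_const_smul g hA)
  have hpair : ∀ e u b : G, Measurable fun x : X => b • x ∈ W ∧ b * u ∈ B ∧ (b * u) • e • x ∈ W :=
    fun e u b => (hmem hW b).and (measurable_const.and
      (measurableSet_setOfPred.mp (measurable_const_smul e (measurable_const_smul (b * u) hW))))
  have hpair' : ∀ u b : G, Measurable fun x : X => b • x ∈ W ∧ b * u ∈ B ∧ (b * u) • x ∈ W :=
    fun u b => (hmem hW b).and (measurable_const.and (hmem hW _))
  have houter : ∀ h b : G, Measurable fun x : X => b • x ∈ W ∧ (b * h) • x ∉ Z ∧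
      ∀ b' ∈ B, (b * h) • x ∈ W → (b'⁻¹ * (b * h)) • x ∉ V :=
    fun h b => (hmem hW b).and ((hmem hZ _).not.and (Measurable.forall fun b' =>
      measurable_const.imp ((hmem hW _).imp (hmem hV _).not)))
  obtain ⟨a, ha, hgood⟩ := exists_measurable_greedy (Q := B → Bool) hκ E
    (fun v τ p => v ∈ V →
      (∀ h ∈ H, m ≤ (outerPositions B W V Z v h).card →
        ∃ b ∈ outerPositions B W V Z v h, patternEval p b ≠ c ((b * h) • v)) ∧
      (∀ u ∈ D, u ≠ 1 → 3 * m ≤ (pairedPositions B W v v u).card →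
        ∃ b ∈ pairedPositions B W v v u, patternEval p b ≠ patternEval p (b * u)) ∧
      (∀ e : E, ∀ u ∈ D, ∀ q, τ e = some q → m ≤ (pairedPositions B W v ((e : G) • v) u).card →
        ∃ b ∈ pairedPositions B W v ((e : G) • v) u,
          patternEval p b ≠ patternEval q (b * u)))
    (fun τ p => by
      refine hV.mem.imp (.and ?_ (.and ?_ ?_))
      · refine .forall fun h => measurable_const.imp (.imp ?_ ?_)
        · exact measurable_le_card_filter B _ (houter h) m
        · simp only [mem_outerPositions]
          refine .exists fun b => .and (measurable_const.and (houter h b)) (.not ?_)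
          exact measurableSet_setOfPred.mp
            (measurableSet_eq_fun measurable_const (hc.comp (measurable_const_smul (b * h))))
      · refine .forall fun u => measurable_const.imp (measurable_const.imp (.imp ?_ ?_))
        · exact measurable_le_card_filter B _ (hpair' u) _
        · simp only [mem_pairedPositions]
          exact .exists fun b => .and (measurable_const.and (hpair' u b)) measurable_const
      · refine .forall fun e => .forall fun u => measurable_const.imp (.forall fun q =>
          measurable_const.imp (.imp ?_ ?_))
        · exact measurable_le_card_filter B _ (hpair e u) _
        · simp only [mem_pairedPositions]
          exact .exists fun b => .and (measurable_const.and (hpair e u b)) measurable_const)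
    (fun v τ => by
      -- The bad patterns, one set per comparison: with the default values, with the own block, and
      -- with a neighbour that has already chosen.
      let A : G ⊕ (G ⊕ E × G) → Finset (B → Bool) := fun i => match i with
        | .inl h => {p | m ≤ (outerPositions B W V Z v h).card ∧
            ∀ b ∈ outerPositions B W V Z v h, patternEval p b = c ((b * h) • v)}
        | .inr (.inl u) => {p | u ≠ 1 ∧ 3 * m ≤ (pairedPositions B W v v u).card ∧
            ∀ b ∈ pairedPositions B W v v u, patternEval p b = patternEval p (b * u)}
        | .inr (.inr (e, u)) => {p | ∃ q, τ e = some q ∧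
            m ≤ (pairedPositions B W v ((e : G) • v) u).card ∧
            ∀ b ∈ pairedPositions B W v ((e : G) • v) u, patternEval p b = patternEval q (b * u)}
      have hpairsub : ∀ v' u, pairedPositions B W v v' u ⊆ B := fun v' u => Finset.filter_subset _ _
      obtain ⟨p, hp⟩ := exists_forall_notMem_of_card (m := m)
        (H.disjSum (D.disjSum (Finset.univ ×ˢ D))) A
        (by simpa [Finset.card_disjSum, Finset.card_product] using hm)
        (by
          rintro i -
          rcases Finset.eq_empty_or_nonempty (A i) with hi | ⟨p₀, hp₀⟩
          · simp [hi]
          rcases i with h | u | ⟨e, u⟩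
          · simp only [A, Finset.mem_filter, Finset.mem_univ, true_and] at hp₀
            refine card_patterns_mul_two_pow_le (Finset.filter_subset _ _) hp₀.1 _ ?_
            intro p hp q hq _ b hb
            simp only [A, Finset.mem_filter, Finset.mem_univ, true_and] at hp hq
            rw [hp.2 b hb, hq.2 b hb]
          · simp only [A, Finset.mem_filter, Finset.mem_univ, true_and] at hp₀
            -- Both sides of a self-comparison vary with the pattern. On `T` the partner `b * u`
            -- lies outside `T`, so values off `T` determine those on `T`; this costs the factor 3.
            obtain ⟨T, hTS, hT, hcard⟩ :=
              exists_subset_translation_independent (pairedPositions B W v v u) hp₀.1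
            refine card_patterns_mul_two_pow_le (hTS.trans (hpairsub v u))
              (by have := hp₀.2.1; omega) _ ?_
            intro p hp q hq hpq b hb
            simp only [A, Finset.mem_filter, Finset.mem_univ, true_and] at hp hq
            rw [hp.2.2 b (hTS hb), hq.2.2 b (hTS hb), hpq _ (hT b hb)]
          · simp only [A, Finset.mem_filter, Finset.mem_univ, true_and] at hp₀
            obtain ⟨r, hr, hmr, -⟩ := hp₀
            refine card_patterns_mul_two_pow_le (hpairsub _ u) hmr _ ?_
            intro p hp q hq _ b hb
            simp only [A, Finset.mem_filter, Finset.mem_univ, true_and, hr, Option.some.injEq,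
              exists_eq_left'] at hp hq
            rw [hp.2 b hb, hq.2 b hb])
      refine ⟨p, fun _ => ⟨fun h hh hcard => ?_, fun u hu hu1 hcard => ?_,
        fun e u hu q hq hcard => ?_⟩⟩
      · by_contra! hcon
        exact hp (.inl h) (by simpa using hh) (by simpa [A] using ⟨hcard, hcon⟩)
      · by_contra! hcon
        exact hp (.inr (.inl u)) (by simpa using hu) (by simpa [A] using ⟨hu1, hcard, hcon⟩)
      · by_contra! hcon
        refine hp (.inr (.inr (e, u))) (by simpa using hu) ?_
        simp only [A, Finset.mem_filter, Finset.mem_univ, true_and]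
        exact ⟨q, hq, hcard, hcon⟩)
  refine ⟨a, ha, fun v hv => ⟨(hgood v hv).1, (hgood v hv).2.1, fun e he hev u hu hcard => ?_⟩⟩
  -- The centre of larger colour guarantees the difference; if that is `e • v`, its rule is read
  -- with `e⁻¹` and `u⁻¹`.
  rcases lt_or_gt_of_ne (hκE v e he) with hlt | hlt
  · exact (hgood v hv).2.2 ⟨e, he⟩ u hu _ (if_pos hlt) hcard
  · have h := (hgood (e • v) hev).2.2 ⟨e⁻¹, hEinv e he⟩ u⁻¹ (hDinv u hu) (a v)
      (by simpa using hlt) (by simpa using hcard.trans (card_pairedPositions_inv_le B W _ _ u))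
    obtain ⟨b, hb, hne⟩ := h
    simp only [inv_smul_smul] at hb
    obtain ⟨h1, h2, h3, h4⟩ := mem_pairedPositions.mp hb
    refine ⟨b * u⁻¹, mem_pairedPositions.mpr ⟨h3, h4, by simpa using h1, by simpa using h2⟩, ?_⟩
    simpa using hne.symm

end Blocks

/-! ### Separating one group element on a syndetic set -/

section Extension

variable {G X : Type*} [Group G] [MulAction G X] [MeasurableSpace X] [StandardBorelSpace X]
  [MeasurableConstSMul G X] [IsCancelSMul G X]

/-- The freedom to change `c` on a syndetic Borel set `U` can be used to separate every `x` from
`g • x`, in a way that is robust under further changes on a smaller syndetic Borel set `U'`. -/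
theorem exists_separating_extension [Countable G] [Infinite G] {U : Set X} (hU : MeasurableSet U)
    (hsynd : ∃ K : Finset G, ∀ x : X, ∃ k ∈ K, k • x ∈ U) {c : X → Bool} (hc : Measurable c)
    {g : G} (hg : g ≠ 1) :
    ∃ U' ⊆ U, MeasurableSet U' ∧ (∃ K : Finset G, ∀ x : X, ∃ k ∈ K, k • x ∈ U') ∧
      ∃ c' : X → Bool, Measurable c' ∧ (∀ y ∉ U, c' y = c y) ∧
        ∀ c'' : X → Bool, (∀ y ∉ U', c'' y = c' y) →
          ∀ x, ∃ k : G, c'' (k • x) ≠ c'' ((k * g) • x) := by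
  classical
  rcases isEmpty_or_nonempty X with hX | ⟨⟨x₀⟩⟩
  · exact ⟨U, subset_rfl, hU, hsynd, c, hc, fun _ _ => rfl, fun _ _ x => hX.elim x⟩
  obtain ⟨K, hK⟩ := hsynd
  obtain ⟨m, hm⟩ := exists_polynomial_lt_two_pow K.card
  -- Two positions may be lost to `U'`. The remaining 5m + 1 force m outer ones, more than 3m in the
  -- own block, or more than m in a single other block.
  obtain ⟨B, hBcard, hB⟩ := exists_finset_many_returns U K hK (5 * m + 3)
  have hBne : B.Nonempty := by
    obtain ⟨T, hTB, hT, -⟩ := hB x₀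
    exact (Finset.card_pos.mp (by omega)).mono hTB
  -- a sparse subset of `U` is left free
  obtain ⟨U', hU'U, hU', hU'sep, hU'max⟩ := exists_measurable_maximal_separated hU
    ((B * B⁻¹).erase 1) (by simp) (fun e he => by
      rw [Finset.mem_erase] at he ⊢
      refine ⟨inv_ne_one.mpr he.1, ?_⟩
      have := Finset.inv_mem_inv he.2
      rwa [mul_inv_rev, inv_inv] at this)
  have hone : ∀ y : X, ∀ b ∈ B, ∀ b' ∈ B, b • y ∈ U' → b' • y ∈ U' → b = b' := by
    intro y b hb b' hb' h h'
    by_contra hne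
    refine hU'sep _ h (b' * b⁻¹) ?_ (by simpa [mul_smul] using h')
    rw [Finset.mem_erase]
    exact ⟨fun h => hne (mul_inv_eq_one.mp h).symm, Finset.mul_mem_mul hb' (Finset.inv_mem_inv hb)⟩
  have hsynd' : ∃ K : Finset G, ∀ x : X, ∃ k ∈ K, k • x ∈ U' := by
    refine ⟨insert 1 (B * B⁻¹) * K, fun x => ?_⟩
    obtain ⟨k, hk, hkU⟩ := hK x
    rcases hU'max _ hkU with h | ⟨e, he, h⟩
    · exact ⟨1 * k, Finset.mul_mem_mul (Finset.mem_insert_self _ _) hk, by simpa using h⟩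
    · exact ⟨e * k, Finset.mul_mem_mul (Finset.mem_insert_of_mem (Finset.mem_of_mem_erase he)) hk,
        by simpa [mul_smul] using h⟩
  -- block centres
  let D : Finset G := B⁻¹ * B
  have hD : ∀ {b b' : G}, b ∈ B → b' ∈ B → b⁻¹ * b' ∈ D := fun hb hb' =>
    Finset.mul_mem_mul (Finset.inv_mem_inv hb) hb'
  have hDinv : ∀ u ∈ D, u⁻¹ ∈ D := fun u hu => by
    have := Finset.inv_mem_inv hu
    rwa [mul_inv_rev, inv_inv] at this
  have h1D : 1 ∈ D := by
    obtain ⟨b, hb⟩ := hBne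
    simpa using hD hb hb
  -- Separation by `D` would already make blocks disjoint; separation by `D * D` also ensures that a
  -- translated block meets at most one block besides its own.
  let F : Finset G := D * D
  have hDF : D ⊆ F := fun u hu => by simpa using Finset.mul_mem_mul hu h1D
  obtain ⟨V, -, hV, hVsep, hVmax⟩ := exists_measurable_maximal_separated
    (MeasurableSet.univ (α := X)) (F.erase 1) (by simp) (fun e he => by
      rw [Finset.mem_erase] at he ⊢
      refine ⟨inv_ne_one.mpr he.1, ?_⟩
      obtain ⟨u, hu, w, hw, rfl⟩ := Finset.mem_mul.mp he.2
      rw [mul_inv_rev]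
      exact Finset.mul_mem_mul (hDinv _ hw) (hDinv _ hu))
  have hVF : ∀ v ∈ V, ∀ f ∈ F, f • v ∈ V → f = 1 := fun v hv f hf h => by
    by_contra hne
    exact hVsep v hv f (Finset.mem_erase.mpr ⟨hne, hf⟩) h
  have hVmeet : ∀ x, ∃ f ∈ F, f • x ∈ V := fun x => by
    rcases hVmax x trivial with h | ⟨f, hf, h⟩
    · exact ⟨1, hDF h1D, by simpa using h⟩
    · exact ⟨f, Finset.mem_of_mem_erase hf, h⟩
  -- Passing from `x` to a centre `f • x` conjugates `g` by `f`.
  let H : Finset G := F.image fun f => f * g * f⁻¹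
  let E : Finset G := (D * H ∪ (D * H)⁻¹).erase 1
  have hEinv : ∀ e ∈ E, e⁻¹ ∈ E := fun e he => by
    simp only [E, Finset.mem_erase, Finset.mem_union] at he ⊢
    refine ⟨inv_ne_one.mpr he.1, he.2.symm.imp (fun h => ?_) (fun h => Finset.inv_mem_inv h)⟩
    exact Finset.mem_inv'.mp h
  -- With n = |B| the terms are at most n⁴, n² and 2n⁸, hence 4n⁸ in total.
  have hcount : H.card + (D.card + E.card * D.card) < 2 ^ m := by
    have hn : 1 ≤ B.card := hBne.card_pos
    have cD : D.card ≤ B.card ^ 2 := by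
      have := Finset.card_mul_le (s := B⁻¹) (t := B)
      rwa [Finset.card_inv, ← sq] at this
    have cF : F.card ≤ B.card ^ 4 := calc
      F.card ≤ D.card * D.card := Finset.card_mul_le
      _ ≤ B.card ^ 2 * B.card ^ 2 := Nat.mul_le_mul cD cD
      _ = B.card ^ 4 := by ring
    have cH : H.card ≤ B.card ^ 4 := Finset.card_image_le.trans cF
    have cDH : (D * H).card ≤ B.card ^ 6 := calc
      (D * H).card ≤ D.card * H.card := Finset.card_mul_le
      _ ≤ B.card ^ 2 * B.card ^ 4 := Nat.mul_le_mul cD cH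
      _ = B.card ^ 6 := by ring
    have cE : E.card ≤ 2 * B.card ^ 6 := by
      have h1 : E.card ≤ _ := Finset.card_erase_le
      have h2 := Finset.card_union_le (D * H) (D * H)⁻¹
      rw [Finset.card_inv] at h2
      omega
    have cED : E.card * D.card ≤ 2 * B.card ^ 8 := calc
      E.card * D.card ≤ 2 * B.card ^ 6 * B.card ^ 2 := Nat.mul_le_mul cE cD
      _ = 2 * B.card ^ 8 := by ring
    have h28 : B.card ^ 2 ≤ B.card ^ 8 := Nat.pow_le_pow_right hn (by norm_num)
    have h48 : B.card ^ 4 ≤ B.card ^ 8 := Nat.pow_le_pow_right hn (by norm_num)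
    have h8 : B.card ^ 8 ≤ ((5 * m + 3) * K.card) ^ 8 := Nat.pow_le_pow_left hBcard 8
    omega
  let W : Set X := U \ U'
  have hW : MeasurableSet W := hU.diff hU'
  obtain ⟨a, ha, hpat⟩ := exists_measurable_patterns hW hV hU' hc B E D H (by simp [E]) hEinv
    hDinv hcount
  -- the new colouring: patterns on the blocks, old values elsewhere
  let A : Set X := {y | (∃ b ∈ B, (y ∈ W ∧ b⁻¹ • y ∈ V) ∧ patternEval (a (b⁻¹ • y)) b = true) ∨
    ((∀ b ∈ B, ¬ (y ∈ W ∧ b⁻¹ • y ∈ V)) ∧ c y = true)}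
  have hA : MeasurableSet A := by
    have hmem : ∀ b : G, Measurable fun y : X => y ∈ W ∧ b⁻¹ • y ∈ V := fun b =>
      hW.mem.and (measurableSet_setOfPred.mp (measurable_const_smul b⁻¹ hV))
    have heval : ∀ b : G, MeasurableSet {x | patternEval (a x) b = true} := fun b => by
      have : {x | patternEval (a x) b = true} =
          ⋃ q : B → Bool, ⋃ _ : patternEval q b = true, {x | a x = q} := by
        ext x; simp
      rw [this]
      exact MeasurableSet.iUnion fun q => MeasurableSet.iUnion fun _ => ha q
    refine Measurable.setOf (.or (.exists fun b => measurable_const.and ((hmem b).and ?_))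
      (.and (.forall fun b => measurable_const.imp (hmem b).not) ?_))
    · exact measurableSet_setOfPred.mp (measurable_const_smul b⁻¹ (heval b))
    · exact measurableSet_setOfPred.mp (hc (measurableSet_singleton true))
  let c' : X → Bool := fun y => if y ∈ A then true else false
  have hc' : Measurable c' := Measurable.ite hA measurable_const measurable_const
  have hdefault : ∀ y, (∀ b ∈ B, y ∈ W → b⁻¹ • y ∉ V) → c' y = c y := by
    intro y hy
    have h : y ∈ A ↔ c y = true :=
      ⟨fun h => h.elim (fun ⟨b, hb, h, _⟩ => (hy b hb h.1 h.2).elim) And.right,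
        fun h => Or.inr ⟨fun b hb h => hy b hb h.1 h.2, h⟩⟩
    by_cases hcy : c y = true <;> simp [c', h, hcy]
  have hblock : ∀ v ∈ V, ∀ b ∈ B, b • v ∈ W → c' (b • v) = patternEval (a v) b := by
    intro v hv b hb hbv
    have h : b • v ∈ A ↔ patternEval (a v) b = true := by
      constructor
      · rintro (⟨b', hb', ⟨-, h⟩, h'⟩ | ⟨h, -⟩)
        · rw [← mul_smul] at h
          obtain rfl : b' = b := inv_mul_eq_one.mp (hVF v hv _ (hDF (hD hb' hb)) h)
          simpa using h'
        · exact (h b hb ⟨hbv, by simpa using hv⟩).elim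
      · exact fun h => Or.inl ⟨b, hb, ⟨hbv, by simpa using hv⟩, by simpa using h⟩
    by_cases hp : patternEval (a v) b = true <;> simp [c', h, hp]
  refine ⟨U', hU'U, hU', hsynd', c', hc', fun y hy => hdefault y fun _ _ h => (hy h.1).elim,
    fun c'' hc'' x => ?_⟩
  obtain ⟨f, hf, hv⟩ := hVmeet x
  set v := f • x with hvdef
  let h : G := f * g * f⁻¹
  have hh : h ∈ H := Finset.mem_image_of_mem _ hf
  have hh1 : h ≠ 1 := fun h1 => hg (by simpa [h] using h1)
  have hblock'' : ∀ v ∈ V, ∀ b ∈ B, b • v ∈ W → c'' (b • v) = patternEval (a v) b :=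
    fun v hv b hb hbv => (hc'' _ hbv.2).trans (hblock v hv b hb hbv)
  suffices hs : ∃ b, c'' (b • v) ≠ c'' ((b * h) • v) by
    obtain ⟨b, hb⟩ := hs
    refine ⟨b * f, ?_⟩
    simpa [hvdef, h, ← mul_smul, mul_assoc] using hb
  have fin_outer : m ≤ (outerPositions B W V U' v h).card →
      ∃ b, c'' (b • v) ≠ c'' ((b * h) • v) := by
    intro hcard
    obtain ⟨b, hb, hne⟩ := (hpat v hv).1 h hh hcard
    obtain ⟨h1, h2, h3, h4⟩ := mem_outerPositions.mp hb
    refine ⟨b, ?_⟩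
    rwa [hblock'' v hv b h1 h2, hc'' _ h3, hdefault _ fun b' hb' hw => by
      rw [← mul_smul]; exact h4 b' hb' hw]
  -- Strictness provides a position even if m = 0, and that position shows `h ∈ D`.
  have fin_own : 3 * m < (pairedPositions B W v v h).card →
      ∃ b, c'' (b • v) ≠ c'' ((b * h) • v) := by
    intro hcard
    obtain ⟨b₀, hb₀⟩ := Finset.card_pos.mp (Nat.zero_lt_of_lt hcard)
    obtain ⟨h1, -, h3, -⟩ := mem_pairedPositions.mp hb₀
    obtain ⟨b, hb, hne⟩ := (hpat v hv).2.1 h (by simpa using hD h1 h3) hh1 hcard.le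
    obtain ⟨h1, h2, h3, h4⟩ := mem_pairedPositions.mp hb
    refine ⟨b, ?_⟩
    rwa [hblock'' v hv b h1 h2, hblock'' v hv _ h3 h4]
  have fin_other : ∀ e ∈ E, e • v ∈ V → m < (pairedPositions B W v (e • v) (h * e⁻¹)).card →
      ∃ b, c'' (b • v) ≠ c'' ((b * h) • v) := by
    intro e he hev hcard
    obtain ⟨b₀, hb₀⟩ := Finset.card_pos.mp (Nat.zero_lt_of_lt hcard)
    obtain ⟨h1, -, h3, -⟩ := mem_pairedPositions.mp hb₀
    obtain ⟨b, hb, hne⟩ := (hpat v hv).2.2 e he hev (h * e⁻¹) (by simpa using hD h1 h3) hcard.le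
    obtain ⟨h1, h2, h3, h4⟩ := mem_pairedPositions.mp hb
    refine ⟨b, ?_⟩
    have hbe : (b * h) • v = (b * (h * e⁻¹)) • e • v := by simp [← mul_smul, mul_assoc]
    rwa [hblock'' v hv b h1 h2, hbe, hblock'' _ hev _ h3 h4]
  -- At these positions neither compared value can be altered by later stages.
  let L : Finset G := {b ∈ B | b • v ∈ W ∧ (b * h) • v ∉ U'}
  have hL : 5 * m + 1 ≤ L.card := by
    obtain ⟨T, hTB, hT, hTU⟩ := hB v
    have hsub : T ⊆ L ∪ ({b ∈ B | b • v ∈ U'} ∪ {b ∈ B | b • h • v ∈ U'} : Finset G) := by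
      intro b hb
      have h1 := hTB hb
      have h2 := hTU b hb
      simp only [L, W, Finset.mem_union, Finset.mem_filter, Set.mem_sdiff, mul_smul]
      tauto
    have h1 := Finset.card_le_card hsub
    have h2 := Finset.card_union_le L ({b ∈ B | b • v ∈ U'} ∪ {b ∈ B | b • h • v ∈ U'})
    have h3 := Finset.card_union_le {b ∈ B | b • v ∈ U'} {b ∈ B | b • h • v ∈ U'}
    have hle : ∀ y : X, ({b ∈ B | b • y ∈ U'} : Finset G).card ≤ 1 := fun y => by
      refine Finset.card_le_one.mpr fun b hb b' hb' => ?_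
      rw [Finset.mem_filter] at hb hb'
      exact hone y b hb.1 b' hb'.1 hb.2 hb'.2
    have h4 := hle v
    have h5 := hle (h • v)
    omega
  have hclass : ∀ b ∈ L, b ∉ outerPositions B W V U' v h → b ∉ pairedPositions B W v v h →
      (b * h) • v ∈ W ∧ ∃ b' ∈ B, b'⁻¹ * (b * h) ∈ E ∧ (b'⁻¹ * (b * h)) • v ∈ V := by
    intro b hb hout hown
    obtain ⟨h1, h2, h3⟩ := Finset.mem_filter.mp hb
    rw [mem_outerPositions] at hout
    push Not at hout
    obtain ⟨b', hb', hbW, hbV⟩ := hout h1 h2 h3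
    refine ⟨hbW, b', hb', ?_, hbV⟩
    simp only [E, Finset.mem_erase, Finset.mem_union]
    refine ⟨fun heq => hown (mem_pairedPositions.mpr ⟨h1, h2, ?_, hbW⟩), Or.inl ?_⟩
    · rwa [← inv_mul_eq_one.mp heq]
    · rw [← mul_assoc]
      exact Finset.mul_mem_mul (hD hb' h1) hh
  -- One foreign position fixes the other centre `e • v`; by `F`-separation all foreign positions
  -- lead to it, and pigeonhole applies.
  by_cases hex : ∃ b ∈ L, b ∉ outerPositions B W V U' v h ∧ b ∉ pairedPositions B W v v h
  · obtain ⟨b₀, hb₀, h₁, h₂⟩ := hex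
    obtain ⟨-, b₁, hb₁, heE, heV⟩ := hclass b₀ hb₀ h₁ h₂
    set e := b₁⁻¹ * (b₀ * h) with he
    have hsub : L ⊆ outerPositions B W V U' v h ∪
        (pairedPositions B W v v h ∪ pairedPositions B W v (e • v) (h * e⁻¹)) := by
      intro b hb
      by_contra hcon
      simp only [Finset.mem_union, not_or] at hcon
      obtain ⟨hout, hown, hoth⟩ := hcon
      obtain ⟨hbW, b', hb', -, hbV⟩ := hclass b hb hout hown
      obtain ⟨hbB, hbvW, -⟩ := Finset.mem_filter.mp hb
      have hb₀B := (Finset.mem_filter.mp hb₀).1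
      have hee : b'⁻¹ * (b * h) = (b'⁻¹ * b * (b₀⁻¹ * b₁)) * e := by
        rw [he]; group
      have h1 : b'⁻¹ * b * (b₀⁻¹ * b₁) = 1 := by
        refine hVF _ heV _ (Finset.mul_mem_mul (hD hb' hbB) (hD hb₀B hb₁)) ?_
        rwa [← mul_smul, ← hee]
      rw [h1, one_mul] at hee
      have hbu : b * (h * e⁻¹) = b' := by
        rw [← hee]; group
      refine hoth (mem_pairedPositions.mpr ⟨hbB, hbvW, hbu ▸ hb', ?_⟩)
      simpa [← mul_smul, mul_assoc] using hbW
    have h1 := Finset.card_le_card hsub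
    have h2 := Finset.card_union_le (outerPositions B W V U' v h)
      (pairedPositions B W v v h ∪ pairedPositions B W v (e • v) (h * e⁻¹))
    have h3 := Finset.card_union_le (pairedPositions B W v v h)
      (pairedPositions B W v (e • v) (h * e⁻¹))
    by_cases c1 : m ≤ (outerPositions B W V U' v h).card
    · exact fin_outer c1
    by_cases c2 : 3 * m < (pairedPositions B W v v h).card
    · exact fin_own c2
    exact fin_other e heE heV (by omega)
  · have hsub : L ⊆ outerPositions B W V U' v h ∪ pairedPositions B W v v h := by
      intro b hb
      by_contra hcon
      simp only [Finset.mem_union, not_or] at hcon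
      exact hex ⟨b, hb, hcon⟩
    have h1 := Finset.card_le_card hsub
    have h2 := Finset.card_union_le (outerPositions B W V U' v h) (pairedPositions B W v v h)
    by_cases c1 : m ≤ (outerPositions B W V U' v h).card
    · exact fin_outer c1
    · exact fin_own (by omega)

/-! ### Treating all group elements; the equivariant map -/

/-- Every free Borel action of a countably infinite group has a Borel set whose translates separate
the points of each orbit. -/
theorem exists_measurable_separating_of_infinite [Countable G] [Infinite G] :
    ∃ c : X → Bool, Measurable c ∧
      ∀ g : G, g ≠ 1 → ∀ x, ∃ k : G, c (k • x) ≠ c ((k * g) • x) := by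
  classical
  let St := {s : Set X × (X → Bool) // MeasurableSet s.1 ∧
    (∃ K : Finset G, ∀ x : X, ∃ k ∈ K, k • x ∈ s.1) ∧ Measurable s.2}
  have hstep : ∀ (s : St) (g : G), ∃ t : St, t.1.1 ⊆ s.1.1 ∧ (∀ y ∉ s.1.1, t.1.2 y = s.1.2 y) ∧
      (g ≠ 1 → ∀ c'' : X → Bool, (∀ y ∉ t.1.1, c'' y = t.1.2 y) →
        ∀ x, ∃ k : G, c'' (k • x) ≠ c'' ((k * g) • x)) := by
    rintro ⟨⟨U, c⟩, hU, hK, hc⟩ g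
    by_cases hg : g = 1
    · exact ⟨⟨⟨U, c⟩, hU, hK, hc⟩, subset_rfl, fun _ _ => rfl, fun h => (h hg).elim⟩
    · obtain ⟨U', hsub, hU', hK', c', hc', hext, hsep⟩ := exists_separating_extension hU hK hc hg
      exact ⟨⟨⟨U', c'⟩, hU', hK', hc'⟩, hsub, hext, fun _ => hsep⟩
  choose next hsub hext hsep using hstep
  obtain ⟨γ, hγ⟩ := exists_surjective_nat G
  let s : ℕ → St := fun n => Nat.rec
    ⟨⟨Set.univ, fun _ => false⟩, .univ, ⟨{1}, fun x => ⟨1, by simp⟩⟩, measurable_const⟩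
    (fun n t => next t (γ n)) n
  have hs : ∀ n, s (n + 1) = next (s n) (γ n) := fun n => rfl
  have hmono : ∀ n d, (s (n + d)).1.1 ⊆ (s n).1.1 := by
    intro n d
    induction d with
    | zero => exact subset_rfl
    | succ d ih => exact (hs (n + d) ▸ hsub _ _ : (s (n + d + 1)).1.1 ⊆ _).trans ih
  have hconst : ∀ n d, ∀ y ∉ (s n).1.1, (s (n + d)).1.2 y = (s n).1.2 y := by
    intro n d y hy
    induction d with
    | zero => rfl
    | succ d ih =>
      rw [← ih, ← add_assoc, hs]
      exact hext _ _ y fun h => hy (hmono n d h)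
  have hagree : ∀ n k, ∀ y ∉ (s n).1.1, y ∉ (s k).1.1 → (s n).1.2 y = (s k).1.2 y := by
    intro n k y hn hk
    rcases le_total n k with h | h <;> obtain ⟨d, rfl⟩ := Nat.exists_eq_add_of_le h
    · exact (hconst n d y hn).symm
    · exact hconst k d y hk
  -- Points that stay undecided forever get `false`; this is harmless because each stage tolerates
  -- any values on its remaining free set.
  let A : Set X := {y | ∃ n, y ∉ (s n).1.1 ∧ (s n).1.2 y = true}
  have hA : MeasurableSet A := Measurable.setOf (.exists fun n => .and (s n).2.1.mem.not
    (measurableSet_setOfPred.mp ((s n).2.2.2 (measurableSet_singleton true))))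
  let c : X → Bool := fun y => if y ∈ A then true else false
  have hc : ∀ n, ∀ y ∉ (s n).1.1, c y = (s n).1.2 y := by
    intro n y hy
    have h : y ∈ A ↔ (s n).1.2 y = true :=
      ⟨fun ⟨k, hk, h⟩ => (hagree n k y hy hk).trans h, fun h => ⟨n, hy, h⟩⟩
    by_cases hcy : (s n).1.2 y = true <;> simp [c, h, hcy]
  refine ⟨c, Measurable.ite hA measurable_const measurable_const, fun g hg x => ?_⟩
  obtain ⟨n, rfl⟩ := hγ g
  exact hsep (s n) (γ n) hg c (fun y hy => hc (n + 1) y hy) x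

/-- Free Borel actions of finite groups have Borel transversals, which separate the points of each
orbit. -/
theorem exists_measurable_separating_of_finite [Finite G] :
    ∃ c : X → Bool, Measurable c ∧
      ∀ g : G, g ≠ 1 → ∀ x, ∃ k : G, c (k • x) ≠ c ((k * g) • x) := by
  classical
  have := Fintype.ofFinite G
  obtain ⟨V, -, hV, hsep, hmax⟩ := exists_measurable_maximal_separated
    (MeasurableSet.univ (α := X)) (Finset.univ.erase (1 : G)) (by simp) (by simp)
  refine ⟨fun y => if y ∈ V then true else false,
    Measurable.ite hV measurable_const measurable_const, fun g hg x => ?_⟩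
  -- `V` meets every orbit exactly once, so this `k` moves `x` into `V` and `g • x` out of it.
  obtain ⟨k, hk⟩ : ∃ k : G, k • x ∈ V := by
    rcases hmax x trivial with h | ⟨e, -, h⟩
    · exact ⟨1, by simpa using h⟩
    · exact ⟨e, h⟩
  refine ⟨k, ?_⟩
  have hkg : (k * g) • x ∉ V := fun h => hsep _ hk (k * g * k⁻¹)
    (Finset.mem_erase.mpr ⟨fun h1 => hg (by simpa using h1), Finset.mem_univ _⟩)
    (by simpa [← mul_smul] using h)
  simp [hk, hkg]

/-- Every free Borel action of a countable group on a standard Borel space has an equivariant Borel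
map to the free part of the `2`-shift. -/
theorem exists_measurable_equivariant_freePart [Countable G] :
    ∃ f : X → freePart G, Measurable f ∧ ∀ (g : G) (x : X), f (g • x) = g • f x := by
  obtain ⟨c, hc, hsep⟩ : ∃ c : X → Bool, Measurable c ∧
      ∀ g : G, g ≠ 1 → ∀ x, ∃ k : G, c (k • x) ≠ c ((k * g) • x) := by
    cases finite_or_infinite G
    · exact exists_measurable_separating_of_finite
    · exact exists_measurable_separating_of_infinite
  let φ : X → TwoShift G := fun x h => c (h⁻¹ • x)
  have hφ : ∀ (g : G) (x : X), φ (g • x) = g • φ x := fun g x => by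
    funext h
    rw [TwoShift.smul_apply]
    simp [φ, mul_smul]
  have hfree : ∀ x, φ x ∈ freePart G := by
    intro x g hg h
    obtain ⟨k, hk⟩ := hsep g hg x
    rw [← hφ] at h
    have := congrFun h k⁻¹
    simp only [φ, inv_inv, ← mul_smul] at this
    exact hk this.symm
  refine ⟨fun x => ⟨φ x, hfree x⟩, ?_, fun g x => Subtype.ext (hφ g x)⟩
  exact Measurable.subtype_mk (measurable_pi_lambda _ fun h => hc.comp (measurable_const_smul h⁻¹))

end Extension

theorem corollary2p5 {G : Type*} [Group G] [Countable G] (S : Set G)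
    {X : Type*} [MeasurableSpace X] [StandardBorelSpace X]
    [MulAction G X] [MeasurableConstSMul G X] [IsCancelSMul G X] :
    borelChromaticNumber (schreierGraph S X) ≤
      borelChromaticNumber (schreierGraph S (freePart G)) := by
  obtain ⟨f, hf, hequiv⟩ := exists_measurable_equivariant_freePart (G := G) (X := X)
  obtain ⟨K, hK, hKs, κ, hκ, hcard⟩ := borelChromaticNumber_mem (schreierGraph S (freePart G))
  refine csInf_le' ⟨K, hK, hKs, SimpleGraph.Coloring.mk (fun x => κ (f x)) ?_, hκ.comp hf, hcard⟩
  rintro x y ⟨s, hs, hs1, rfl⟩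
  exact κ.valid ⟨s, hs, hs1, hequiv s x⟩
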